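/- Let $n\ge 1$ and $s\ge 2$, and let $M$ be a smooth manifold of dimension $2n+s$ with a weak metric $f$-structure $(f,Q,\xi_i,\eta^i,g)$, $1\le i\le s$: $f$ is a smooth $(1,1)$-tensor of rank $2n$, $Q$ is a smooth nonsingular $(1,1)$-tensor, $\xi_i$ are smooth vector fields, $\eta^i$ are smooth 1-forms, and $g$ is a Riemannian metric, such that $$f^3+fQ=0,\quad f^2=-Q+\sum_i\eta^i\otimes\xi_i,\quad \eta^i(\xi_j)=\delta^i_j,\quad Q\,\xi_i=\xi_i,$$ the distribution $\bigcap_i\ker\eta^i$ is $f$-invariant, and $g(fX,fY)=g(X,QY)-\sum_i\eta^i(X)\,\eta^i(Y)$ for all vector fields $X,Y$. Let $\nabla$ be the Levi-Civita connection of $g$, and let $\bar\xi=\sum_i\xi_i$, $\bar\eta=\sum_i\eta^i$. Suppose that, for a constant $\beta\ne0$, this is a weak $\beta$-Kenmotsu $f$-manifold, that is, for all vector fields $X,Y$, $$[f,f](X,Y)+2\sum_i d\eta^i(X,Y)\,\xi_i=0,\qquad (\nabla_Xf)Y=\beta\{g(fX,Y)\,\bar\xi-\bar\eta(Y)\,fX\},$$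 where $[f,f](X,Y)=f^2[X,Y]+[fX,fY]-f[fX,Y]-f[X,fY]$ and $2\,d\omega(X,Y)=X(\omega(Y))-Y(\omega(X))-\omega([X,Y])$ for a 1-form $\omega$. Let $R_{X,Y}=[\nabla_X,\nabla_Y]-\nabla_{[X,Y]}$, ${\rm Ric}(X,Y)={\rm trace}(Z\mapsto R_{Z,X}Y)$, $g({\rm Ric}^\sharp X,Y)={\rm Ric}(X,Y)$ and $r={\rm trace}\,{\rm Ric}^\sharp$. If $\nabla_{\xi_i}{\rm Ric}^\sharp=0$ for some index $i$ (in particular, if this holds for all $i$), then $(M,g)$ is $\eta$-Einstein, i.e. there are $a,b\in C^\infty(M)$ with $${\rm Ric}=a\,g+b\sum_i\eta^i\otimes\eta^i+(a+b)\sum_{i\ne j}\eta^i\otimes\eta^j,$$ and its scalar curvature is $r=-2\,s\,n\,(2n+1)\,\beta^2$. -/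

import Mathlib

open scoped Manifold ContDiff
open Bundle

set_option maxSynthPendingDepth 3

noncomputable section

/-! ### Riemannian geometry of a metric given in coordinates

`E` is the coordinate space; `G y` is the matrix of the metric at the coordinate point `y`,
as a bilinear form. All formulas below are the classical coordinate expressions. -/

namespace LocalRiem

variable {E : Type*} [NormedAddCommGroup E] [NormedSpace ℝ E]

/-- Exchange of the last two arguments of a trilinear map. -/
def flipLast {F : Type*} [NormedAddCommGroup F] [NormedSpace ℝ F]
    (T : E →L[ℝ] E →L[ℝ] E →L[ℝ] F) : E →L[ℝ] E →L[ℝ] E →L[ℝ] F :=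
  ((ContinuousLinearMap.flipₗᵢ ℝ E E F).toContinuousLinearEquiv.toContinuousLinearMap) ∘L T

theorem flipLast_apply {F : Type*} [NormedAddCommGroup F] [NormedSpace ℝ F]
    (T : E →L[ℝ] E →L[ℝ] E →L[ℝ] F) (u v w : E) : flipLast T u v w = T u w v := rfl

/-- Christoffel symbols of the first kind:
`(u, v, w) ↦ (1/2) (∂_u G(v, w) + ∂_v G(u, w) - ∂_w G(u, v))`. -/
def christoffelFirst (G : E → E →L[ℝ] E →L[ℝ] ℝ) (y : E) : E →L[ℝ] E →L[ℝ] E →L[ℝ] ℝ :=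
  let D : E →L[ℝ] E →L[ℝ] E →L[ℝ] ℝ := fderiv ℝ G y
  (1 / 2 : ℝ) • (D + D.flip - flipLast D.flip)

theorem christoffelFirst_apply (G : E → E →L[ℝ] E →L[ℝ] ℝ) (y u v w : E) :
    christoffelFirst G y u v w =
      (1 / 2 : ℝ) * (fderiv ℝ G y u v w + fderiv ℝ G y v u w - fderiv ℝ G y w u v) := rfl

/-- Christoffel symbols (of the second kind) of the Levi-Civita connection:
`G (Γ(u, v), w) = christoffelFirst G u v w`. For constant vector fields, `∇_u v = Γ(u, v)`.
(`ContinuousLinearMap.inverse` is the honest inverse where `G y` is nondegenerate and `E` is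
finite-dimensional.) -/
def christoffel (G : E → E →L[ℝ] E →L[ℝ] ℝ) (y : E) : E →L[ℝ] E →L[ℝ] E :=
  (ContinuousLinearMap.compL ℝ E (E →L[ℝ] ℝ) E (G y).inverse) ∘L christoffelFirst G y

theorem christoffel_apply (G : E → E →L[ℝ] E →L[ℝ] ℝ) (y u v : E) :
    christoffel G y u v = (G y).inverse (christoffelFirst G y u v) := rfl

/-- Covariant derivative of a (1,1)-tensor field `A`: `(∇_u A) v = (∂_u A) v + Γ(u, A v) - A Γ(u, v)`,
as the map `u ↦ ∇_u A`. -/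
def covDerivEndo (G : E → E →L[ℝ] E →L[ℝ] ℝ) (A : E → E →L[ℝ] E) (y : E) :
    E →L[ℝ] E →L[ℝ] E :=
  fderiv ℝ A y + (ContinuousLinearMap.compL ℝ E E E).flip (A y) ∘L christoffel G y -
    (ContinuousLinearMap.compL ℝ E E E (A y)) ∘L christoffel G y

theorem covDerivEndo_apply (G : E → E →L[ℝ] E →L[ℝ] ℝ) (A : E → E →L[ℝ] E) (y u v : E) :
    covDerivEndo G A y u v =
      fderiv ℝ A y u v + christoffel G y u (A y v) - A y (christoffel G y u v) := rfl

/-- Curvature tensor `R_{u,v} w` with `R_{X,Y} = [∇_X, ∇_Y] - ∇_{[X,Y]}`. On constant vector fields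
this is `∂_u Γ(v, w) - ∂_v Γ(u, w) + Γ(u, Γ(v, w)) - Γ(v, Γ(u, w))`. -/
def curvature (G : E → E →L[ℝ] E →L[ℝ] ℝ) (y : E) : E →L[ℝ] E →L[ℝ] E →L[ℝ] E :=
  fderiv ℝ (christoffel G) y - (fderiv ℝ (christoffel G) y).flip +
    (ContinuousLinearMap.compL ℝ E E E).bilinearComp (christoffel G y) (christoffel G y) -
    ((ContinuousLinearMap.compL ℝ E E E).bilinearComp (christoffel G y) (christoffel G y)).flip

theorem curvature_apply (G : E → E →L[ℝ] E →L[ℝ] ℝ) (y u v w : E) :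
    curvature G y u v w =
      fderiv ℝ (christoffel G) y u v w - fderiv ℝ (christoffel G) y v u w +
        christoffel G y u (christoffel G y v w) - christoffel G y v (christoffel G y u w) := rfl

variable [FiniteDimensional ℝ E]

/-- The trace of an endomorphism, as a continuous linear form. -/
def traceCLM (E : Type*) [NormedAddCommGroup E] [NormedSpace ℝ E] [FiniteDimensional ℝ E] :
    (E →L[ℝ] E) →L[ℝ] ℝ :=
  LinearMap.toContinuousLinearMap (LinearMap.trace ℝ E ∘ₗ ContinuousLinearMap.coeLM ℝ)

/-- Ricci tensor `Ric(u, v) = trace (w ↦ R_{w,u} v)`. -/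
def ricci (G : E → E →L[ℝ] E →L[ℝ] ℝ) (y : E) : E →L[ℝ] E →L[ℝ] ℝ :=
  (ContinuousLinearMap.compL ℝ E (E →L[ℝ] E) ℝ (traceCLM E)) ∘L flipLast (curvature G y).flip

theorem ricci_apply (G : E → E →L[ℝ] E →L[ℝ] ℝ) (y u v : E) :
    ricci G y u v =
      LinearMap.trace ℝ E (((curvature G y).flip u).flip v : E →L[ℝ] E).toLinearMap := rfl

/-- Ricci operator: `G (Ric♯ u, v) = Ric(u, v)`. -/
def ricciOp (G : E → E →L[ℝ] E →L[ℝ] ℝ) (y : E) : E →L[ℝ] E :=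
  (G y).inverse ∘L ricci G y

/-- Scalar curvature, the metric trace of the Ricci tensor, i.e. the trace of `Ric♯`. -/
def scalarCurvature (G : E → E →L[ℝ] E →L[ℝ] ℝ) (y : E) : ℝ :=
  LinearMap.trace ℝ E (ricciOp G y).toLinearMap

end LocalRiem

/-- The coordinate space of a `(2n+s)`-dimensional manifold. -/
abbrev CoordSpace (n s : ℕ) : Type := EuclideanSpace ℝ (Fin (2 * n + s))

/-! ### Tensor fields on a manifold and their coordinate expressions

`c : M` selects the chart `extChartAt 𝓘(ℝ, E) c` around `c`; a point `y` of its target stands for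
the point `(extChartAt 𝓘(ℝ, E) c).symm y` of the manifold. -/

namespace ChartRep

variable {E : Type*} [NormedAddCommGroup E] [NormedSpace ℝ E]
  {M : Type*} [TopologicalSpace M] [ChartedSpace E M]

/-- The point of `M` with coordinates `y` in the chart at `c`. -/
def pt (c : M) (y : E) : M := (extChartAt 𝓘(ℝ, E) c).symm y

/-- Differential of the inverse chart: coordinate vectors at `y` to tangent vectors. -/
def toTangent (c : M) (y : E) : E →L[ℝ] TangentSpace 𝓘(ℝ, E) (pt c y) :=
  mfderiv 𝓘(ℝ, E) 𝓘(ℝ, E) (extChartAt 𝓘(ℝ, E) c).symm y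

/-- Differential of the chart: tangent vectors to coordinate vectors at `y`. -/
def ofTangent (c : M) (y : E) : TangentSpace 𝓘(ℝ, E) (pt c y) →L[ℝ] E :=
  mfderiv 𝓘(ℝ, E) 𝓘(ℝ, E) (extChartAt 𝓘(ℝ, E) c) (pt c y)

/-- Coordinate expression of a vector field. -/
def vec (ξ : Π p : M, TangentSpace 𝓘(ℝ, E) p) (c : M) (y : E) : E :=
  ofTangent c y (ξ (pt c y))

/-- Coordinate expression of a 1-form. -/
def form (η : Π p : M, TangentSpace 𝓘(ℝ, E) p →L[ℝ] ℝ) (c : M) (y : E) : E →L[ℝ] ℝ :=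
  (η (pt c y)) ∘L toTangent c y

/-- Coordinate expression of a (1,1)-tensor field. -/
def endo (A : Π p : M, TangentSpace 𝓘(ℝ, E) p →L[ℝ] TangentSpace 𝓘(ℝ, E) p) (c : M) (y : E) :
    E →L[ℝ] E :=
  ofTangent c y ∘L A (pt c y) ∘L toTangent c y

/-- Coordinate expression of a (0,2)-tensor field. -/
def bilin (B : Π p : M, TangentSpace 𝓘(ℝ, E) p →L[ℝ] TangentSpace 𝓘(ℝ, E) p →L[ℝ] ℝ)
    (c : M) (y : E) : E →L[ℝ] E →L[ℝ] ℝ :=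
  let b : E →L[ℝ] E →L[ℝ] ℝ := B (pt c y)
  let φ : E →L[ℝ] E := toTangent c y
  b.bilinearComp φ φ

end ChartRep

/-- Nijenhuis torsion `[A,A](X,Y) = A²[X,Y] + [AX,AY] - A[AX,Y] - A[X,AY]` in coordinates. -/
def nijenhuis {E : Type*} [NormedAddCommGroup E] [NormedSpace ℝ E]
    (A : E → E →L[ℝ] E) (X Y : E → E) (y : E) : E :=
  A y (A y (VectorField.lieBracket ℝ X Y y))
    + VectorField.lieBracket ℝ (fun z => A z (X z)) (fun z => A z (Y z)) y
    - A y (VectorField.lieBracket ℝ (fun z => A z (X z)) Y y)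
    - A y (VectorField.lieBracket ℝ X (fun z => A z (Y z)) y)

/-- `dα(X,Y) = (1/2) {X(α(Y)) - Y(α(X)) - α([X,Y])}` in coordinates. -/
def extDerivOneForm {E : Type*} [NormedAddCommGroup E] [NormedSpace ℝ E]
    (α : E → E →L[ℝ] ℝ) (X Y : E → E) (y : E) : ℝ :=
  (1 / 2 : ℝ) * (fderiv ℝ (fun z => α z (Y z)) y (X y) - fderiv ℝ (fun z => α z (X z)) y (Y y)
    - α y (VectorField.lieBracket ℝ X Y y))

/-! ### Weak metric `f`-structures -/

/-- A framed weak `f`-structure `(f, Q, ξ_i, η^i)` on a manifold `M` of dimension `2n+s`, whose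
contact distribution `⋂ ker η^i` is `f`-invariant. -/
structure FramedWeakFStructure (n s : ℕ) (M : Type*) [TopologicalSpace M]
    [ChartedSpace (CoordSpace n s) M] [IsManifold 𝓘(ℝ, CoordSpace n s) ∞ M] where
  f : Π p : M, TangentSpace 𝓘(ℝ, CoordSpace n s) p →L[ℝ] TangentSpace 𝓘(ℝ, CoordSpace n s) p
  Q : Π p : M, TangentSpace 𝓘(ℝ, CoordSpace n s) p →L[ℝ] TangentSpace 𝓘(ℝ, CoordSpace n s) p
  ξ : Fin s → Π p : M, TangentSpace 𝓘(ℝ, CoordSpace n s) p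
  η : Fin s → Π p : M, TangentSpace 𝓘(ℝ, CoordSpace n s) p →L[ℝ] ℝ
  smooth_f : ContMDiff 𝓘(ℝ, CoordSpace n s)
    (𝓘(ℝ, CoordSpace n s).prod 𝓘(ℝ, CoordSpace n s →L[ℝ] CoordSpace n s)) ∞
    (fun p => TotalSpace.mk' (CoordSpace n s →L[ℝ] CoordSpace n s)
      (E := fun p : M => TangentSpace 𝓘(ℝ, CoordSpace n s) p →L[ℝ]
        TangentSpace 𝓘(ℝ, CoordSpace n s) p) p (f p))
  smooth_Q : ContMDiff 𝓘(ℝ, CoordSpace n s)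
    (𝓘(ℝ, CoordSpace n s).prod 𝓘(ℝ, CoordSpace n s →L[ℝ] CoordSpace n s)) ∞
    (fun p => TotalSpace.mk' (CoordSpace n s →L[ℝ] CoordSpace n s)
      (E := fun p : M => TangentSpace 𝓘(ℝ, CoordSpace n s) p →L[ℝ]
        TangentSpace 𝓘(ℝ, CoordSpace n s) p) p (Q p))
  smooth_ξ : ∀ i, ContMDiff 𝓘(ℝ, CoordSpace n s)
    (𝓘(ℝ, CoordSpace n s).prod 𝓘(ℝ, CoordSpace n s)) ∞
    (fun p => TotalSpace.mk' (CoordSpace n s)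
      (E := fun p : M => TangentSpace 𝓘(ℝ, CoordSpace n s) p) p (ξ i p))
  smooth_η : ∀ i, ContMDiff 𝓘(ℝ, CoordSpace n s)
    (𝓘(ℝ, CoordSpace n s).prod 𝓘(ℝ, CoordSpace n s →L[ℝ] ℝ)) ∞
    (fun p => TotalSpace.mk' (CoordSpace n s →L[ℝ] ℝ)
      (E := fun p : M => TangentSpace 𝓘(ℝ, CoordSpace n s) p →L[ℝ] Trivial M ℝ p) p (η i p))
  rank_f : ∀ p, Module.finrank ℝ (LinearMap.range (f p).toLinearMap) = 2 * n
  nonsingular_Q : ∀ p, Function.Bijective (Q p)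
  f_cubed : ∀ p X, f p (f p (f p X)) + f p (Q p X) = 0
  f_squared : ∀ p X, f p (f p X) = -(Q p X) + ∑ i, η i p X • ξ i p
  η_ξ : ∀ p i j, η i p (ξ j p) = if i = j then 1 else 0
  Q_ξ : ∀ p i, Q p (ξ i p) = ξ i p
  f_invariant : ∀ p X, (∀ i, η i p X = 0) → ∀ i, η i p (f p X) = 0

/-- A weak metric `f`-structure: a framed weak `f`-structure with a compatible Riemannian metric. -/
structure WeakMetricFStructure (n s : ℕ) (M : Type*) [TopologicalSpace M]
    [ChartedSpace (CoordSpace n s) M] [IsManifold 𝓘(ℝ, CoordSpace n s) ∞ M]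
    extends FramedWeakFStructure n s M where
  g : ContMDiffRiemannianMetric 𝓘(ℝ, CoordSpace n s) ∞ (CoordSpace n s)
    (fun p : M => TangentSpace 𝓘(ℝ, CoordSpace n s) p)
  compatible : ∀ p X Y, g.inner p (f p X) (f p Y) = g.inner p X (Q p Y) - ∑ i, η i p X * η i p Y

namespace WeakMetricFStructure

variable {n s : ℕ} {M : Type*} [TopologicalSpace M] [ChartedSpace (CoordSpace n s) M]
  [IsManifold 𝓘(ℝ, CoordSpace n s) ∞ M] (S : WeakMetricFStructure n s M)

/-- Coordinate expression of the metric in the chart at `c`. -/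
def localMetric (c : M) : CoordSpace n s → CoordSpace n s →L[ℝ] CoordSpace n s →L[ℝ] ℝ :=
  ChartRep.bilin S.g.inner c

/-- `ξ̄ = ∑ ξ_i`. -/
def xiBar (p : M) : TangentSpace 𝓘(ℝ, CoordSpace n s) p := ∑ i, S.ξ i p

/-- `η̄ = ∑ η^i`. -/
def etaBar (p : M) : TangentSpace 𝓘(ℝ, CoordSpace n s) p →L[ℝ] ℝ := ∑ i, S.η i p

/-- Normality: `[f,f](X,Y) + 2 ∑ dη^i(X,Y) ξ_i = 0` for all smooth vector fields, in every chart. -/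
def IsNormal : Prop :=
  ∀ c : M, ∀ y ∈ (extChartAt 𝓘(ℝ, CoordSpace n s) c).target,
    ∀ X Y : CoordSpace n s → CoordSpace n s, ContDiff ℝ ∞ X → ContDiff ℝ ∞ Y →
      nijenhuis (ChartRep.endo S.f c) X Y y
        + ∑ i, (2 * extDerivOneForm (ChartRep.form (S.η i) c) X Y y) • ChartRep.vec (S.ξ i) c y = 0

/-- Weak `β`-Kenmotsu `f`-manifold: normal, with
`(∇_X f) Y = β {g(f X, Y) ξ̄ - η̄(Y) f X}` (read in every chart). -/
structure IsWeakKenmotsu (β : M → ℝ) : Prop where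
  smooth_β : ContMDiff 𝓘(ℝ, CoordSpace n s) 𝓘(ℝ, ℝ) ∞ β
  β_ne_zero : ∀ p, β p ≠ 0
  normal : S.IsNormal
  nabla_f : ∀ c : M, ∀ y ∈ (extChartAt 𝓘(ℝ, CoordSpace n s) c).target, ∀ X Y : CoordSpace n s,
    LocalRiem.covDerivEndo (S.localMetric c) (ChartRep.endo S.f c) y X Y =
      β (ChartRep.pt c y) •
        (S.localMetric c y (ChartRep.endo S.f c y X) Y • ChartRep.vec S.xiBar c y
          - ChartRep.form S.etaBar c y Y • ChartRep.endo S.f c y X)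

/-- `∇_{ξ_i} Ric♯ = 0` (read in every chart). -/
def NablaXiRicciOpEqZero (i : Fin s) : Prop :=
  ∀ c : M, ∀ y ∈ (extChartAt 𝓘(ℝ, CoordSpace n s) c).target,
    LocalRiem.covDerivEndo (S.localMetric c) (LocalRiem.ricciOp (S.localMetric c)) y
      (ChartRep.vec (S.ξ i) c y) = 0

/-- `Ric = a g + b ∑ η^i ⊗ η^i + (a+b) ∑_{i ≠ j} η^i ⊗ η^j` for some smooth `a, b`
(read in every chart). -/
def IsEtaEinstein : Prop :=
  ∃ a b : M → ℝ, ContMDiff 𝓘(ℝ, CoordSpace n s) 𝓘(ℝ, ℝ) ∞ a ∧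
    ContMDiff 𝓘(ℝ, CoordSpace n s) 𝓘(ℝ, ℝ) ∞ b ∧
    ∀ c : M, ∀ y ∈ (extChartAt 𝓘(ℝ, CoordSpace n s) c).target, ∀ X Y : CoordSpace n s,
      LocalRiem.ricci (S.localMetric c) y X Y =
        a (ChartRep.pt c y) * S.localMetric c y X Y
        + b (ChartRep.pt c y) *
          ∑ i, ChartRep.form (S.η i) c y X * ChartRep.form (S.η i) c y Y
        + (a (ChartRep.pt c y) + b (ChartRep.pt c y)) *
          ∑ i, ∑ j ∈ Finset.univ.filter (fun j => j ≠ i),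
            ChartRep.form (S.η i) c y X * ChartRep.form (S.η j) c y Y

/-- The scalar curvature of `g` is constantly `r` (read in every chart). -/
def HasScalarCurvature (r : ℝ) : Prop :=
  ∀ c : M, ∀ y ∈ (extChartAt 𝓘(ℝ, CoordSpace n s) c).target,
    LocalRiem.scalarCurvature (S.localMetric c) y = r

end WeakMetricFStructure

end

/-! Everything is computed in a chart, with P the projection orthogonal to all ξ_k. The structure
equations first give ∇_u ξ_j = β P u (`isKenmotsuFrame_of_normal`). Indeed, differentiating f ξ_j =
0 fixes ∇_u ξ_j up to a combination of the ξ_k. The formula for ∇f makes [f,f] vanish, so normality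
forces dη^k = 0, and this together with orthonormality kills the vertical part.

From then on f and Q play no role. Commuting second derivatives of ξ_j gives R(u,v)ξ_j
(`curvature_xi`), and pair symmetry gives R(v,ξ_j)z. Hence Ric(ξ_j,v) = -2nβ² η̄(v). The second
Bianchi identity then expresses ∇_{ξ_j}R through R itself and explicit terms
(`covDeriv_curvature_xi`). Its trace on horizontal vectors is (∇_{ξ_j}Ric)(v,z) = -2β (Ric(v,z) +
2snβ² g(v,z)) (`covDeriv_ricci_xi`).

If the left side vanishes, then Ric = -2snβ² g on horizontal vectors, since β ≠ 0. Altogether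
Ric(u,v) = -2nβ² (s g(Pu,v) + η̄(u) η̄(v)), which is η-Einstein; its metric trace is r. -/

namespace LocalRiem

/-! ### Product rules and symmetry of second derivatives -/

section Calculus

variable {E F F' : Type*} [NormedAddCommGroup E] [NormedSpace ℝ E] [NormedAddCommGroup F]
  [NormedSpace ℝ F] [NormedAddCommGroup F'] [NormedSpace ℝ F'] {y : E}

theorem fderiv_clm_apply_eq {A : E → F →L[ℝ] F'} {x : E → F} (hA : DifferentiableAt ℝ A y)
    (hx : DifferentiableAt ℝ x y) (u : E) :
    fderiv ℝ (fun z => A z (x z)) y u = fderiv ℝ A y u (x y) + A y (fderiv ℝ x y u) := by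
  rw [fderiv_clm_apply hA hx]
  simp [add_comm]

theorem fderiv_clm_apply_const {A : E → F →L[ℝ] F'} (hA : DifferentiableAt ℝ A y) (x : F) (u : E) :
    fderiv ℝ (fun z => A z x) y u = fderiv ℝ A y u x := by
  rw [fderiv_clm_apply_eq hA (differentiableAt_const x)]
  simp

theorem fderiv_bilin_apply_eq {H : Type*} [NormedAddCommGroup H] [NormedSpace ℝ H]
    {B : E → F →L[ℝ] F' →L[ℝ] H} {x : E → F} {w : E → F'}
    (hB : DifferentiableAt ℝ B y) (hx : DifferentiableAt ℝ x y) (hw : DifferentiableAt ℝ w y)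
    (u : E) :
    fderiv ℝ (fun z => B z (x z) (w z)) y u =
      fderiv ℝ B y u (x y) (w y) + B y (fderiv ℝ x y u) (w y) + B y (x y) (fderiv ℝ w y u) := by
  rw [fderiv_clm_apply_eq (hB.clm_apply hx) hw, fderiv_clm_apply_eq hB hx]
  simp

theorem fderiv_fderiv_comm {A : E → F} {U : Set E} (hU : IsOpen U) (hA : ContDiffOn ℝ ∞ A U)
    (hy : y ∈ U) (u v : E) :
    fderiv ℝ (fderiv ℝ A) y u v = fderiv ℝ (fderiv ℝ A) y v u :=
  ((hA.contDiffAt (hU.mem_nhds hy)).isSymmSndFDerivAt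
    (by simpa using WithTop.coe_le_coe.2 (le_top : (2 : ℕ∞) ≤ ⊤))).eq u v

theorem fderiv_eq_of_eqOn {A B : E → F} {U : Set E} (hU : IsOpen U) (h : Set.EqOn A B U)
    (hy : y ∈ U) : fderiv ℝ A y = fderiv ℝ B y :=
  (h.eventuallyEq_of_mem (hU.mem_nhds hy)).fderiv_eq

theorem differentiableAt_of_contDiffOn {A : E → F} {U : Set E} (hU : IsOpen U)
    (hA : ContDiffOn ℝ ∞ A U) (hy : y ∈ U) : DifferentiableAt ℝ A y :=
  (hA.contDiffAt (hU.mem_nhds hy)).differentiableAt (by simp)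

theorem contDiffOn_fderiv {A : E → F} {U : Set E} (hU : IsOpen U)
    (hA : ContDiffOn ℝ ∞ A U) : ContDiffOn ℝ ∞ (fderiv ℝ A) U :=
  hA.fderiv_of_isOpen hU (by simp)

end Calculus

/-! ### Levi-Civita connection, curvature symmetries and Bianchi identities in coordinates -/

variable {E : Type*} [NormedAddCommGroup E] [NormedSpace ℝ E]

theorem curvature_antisymm (G : E → E →L[ℝ] E →L[ℝ] ℝ) (y u v w : E) :
    curvature G y u v w = - curvature G y v u w := by
  rw [curvature_apply, curvature_apply]; abel

/-- `G` is a smooth Riemannian metric on the open set `U` of the coordinate space. -/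
structure IsMetricOn (G : E → E →L[ℝ] E →L[ℝ] ℝ) (U : Set E) : Prop where
  isOpen : IsOpen U
  smooth : ContDiffOn ℝ ∞ G U
  symm : ∀ y ∈ U, ∀ u v, G y u v = G y v u
  pos : ∀ y ∈ U, ∀ u, u ≠ 0 → 0 < G y u u

namespace IsMetricOn

variable {G : E → E →L[ℝ] E →L[ℝ] ℝ} {U : Set E} (h : IsMetricOn G U) {y : E} (hy : y ∈ U)
include h hy

theorem eq_of_inner_eq {a b : E} (hab : ∀ w, G y a w = G y b w) : a = b := by
  by_contra hne
  have := h.pos y hy (a - b) (sub_ne_zero.2 hne)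
  simp [hab] at this

theorem fderiv_symm (u v w : E) : fderiv ℝ G y u v w = fderiv ℝ G y u w v := by
  have hd := differentiableAt_of_contDiffOn h.isOpen h.smooth hy
  have h1 : ∀ a b : E, fderiv ℝ (fun z => G z a b) y u = fderiv ℝ G y u a b := fun a b => by
    rw [fderiv_bilin_apply_eq hd (differentiableAt_const a) (differentiableAt_const b)]; simp
  rw [← h1, ← h1, fderiv_eq_of_eqOn h.isOpen (fun z hz => h.symm z hz v w) hy]

/-- `ContinuousLinearMap.inverse` is zero on noninvertible maps, so every formula with a raised
index depends on this fact. Definiteness gives injectivity, and E and its dual have equal dimension.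
-/
theorem isInvertible [FiniteDimensional ℝ E] : (G y).IsInvertible := by
  have hinj : Function.Injective (G y) := fun a b hab =>
    h.eq_of_inner_eq hy fun w => by rw [hab]
  have hdim : Module.finrank ℝ E = Module.finrank ℝ (E →L[ℝ] ℝ) := by
    rw [← (LinearMap.toContinuousLinearMap : (E →ₗ[ℝ] ℝ) ≃ₗ[ℝ] _).finrank_eq]
    exact (Subspace.dual_finrank_eq (K := ℝ) (V := E)).symm
  exact ⟨(LinearEquiv.ofInjectiveOfFinrankEq (G y).toLinearMap hinj hdim).toContinuousLinearEquiv,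
    by ext; rfl⟩

variable [FiniteDimensional ℝ E]

theorem inverse_apply (φ : E →L[ℝ] ℝ) (w : E) : G y ((G y).inverse φ) w = φ w := by
  rw [(h.isInvertible hy).self_apply_inverse]

theorem inner_christoffel (u v w : E) :
    G y (christoffel G y u v) w = christoffelFirst G y u v w := by
  rw [christoffel_apply, h.inverse_apply hy]

theorem christoffel_symm (u v : E) : christoffel G y u v = christoffel G y v u :=
  h.eq_of_inner_eq hy fun w => by
    rw [h.inner_christoffel hy, h.inner_christoffel hy, christoffelFirst_apply,
      christoffelFirst_apply, h.fderiv_symm hy w u v]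
    ring

/-- Metric compatibility ∇G = 0; it trades derivatives of the metric for Christoffel symbols. -/
theorem fderiv_eq (u v w : E) : fderiv ℝ G y u v w =
    G y (christoffel G y u v) w + G y v (christoffel G y u w) := by
  rw [h.symm y hy v, h.inner_christoffel hy, h.inner_christoffel hy, christoffelFirst_apply,
      christoffelFirst_apply, h.fderiv_symm hy u w v]
  ring

omit hy in
theorem contDiffOn_inverse : ContDiffOn ℝ ∞ (fun z => (G z).inverse) U := fun z hz =>
  (h.isInvertible hz).contDiffAt_map_inverse.comp_contDiffWithinAt z (h.smooth z hz)

omit hy in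
theorem contDiffOn_christoffelFirst : ContDiffOn ℝ ∞ (christoffelFirst G) U := by
  have hD := contDiffOn_fderiv h.isOpen h.smooth
  refine contDiffOn_clm_apply.2 fun u => contDiffOn_clm_apply.2 fun v =>
    contDiffOn_clm_apply.2 fun w => ?_
  simp only [christoffelFirst_apply]
  fun_prop

omit hy in
theorem contDiffOn_christoffel : ContDiffOn ℝ ∞ (christoffel G) U := by
  have hD := h.contDiffOn_christoffelFirst
  have hI := h.contDiffOn_inverse
  refine contDiffOn_clm_apply.2 fun u => contDiffOn_clm_apply.2 fun v => ?_
  simp only [christoffel_apply]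
  fun_prop

omit hy in
theorem contDiffOn_curvature : ContDiffOn ℝ ∞ (curvature G) U := by
  have hC := h.contDiffOn_christoffel
  have hD := contDiffOn_fderiv h.isOpen hC
  refine contDiffOn_clm_apply.2 fun u => contDiffOn_clm_apply.2 fun v =>
    contDiffOn_clm_apply.2 fun w => ?_
  simp only [curvature_apply]
  fun_prop

omit hy in
theorem contDiffOn_ricci : ContDiffOn ℝ ∞ (ricci G) U := by
  have hC := h.contDiffOn_curvature
  refine contDiffOn_clm_apply.2 fun u => contDiffOn_clm_apply.2 fun v => ?_
  have : ∀ z, ricci G z u v = traceCLM E (((curvature G z).flip u).flip v) := fun z => rfl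
  simp only [this]
  refine (traceCLM E).contDiff.comp_contDiffOn (contDiffOn_clm_apply.2 fun w => ?_)
  simp only [ContinuousLinearMap.flip_apply]
  fun_prop

omit hy in
theorem contDiffOn_ricciOp : ContDiffOn ℝ ∞ (ricciOp G) U :=
  h.contDiffOn_inverse.clm_comp h.contDiffOn_ricci

theorem inner_ricciOp (u v : E) : G y (ricciOp G y u) v = ricci G y u v :=
  h.inverse_apply hy _ _

theorem fderiv_christoffel_symm (u v w : E) :
    fderiv ℝ (christoffel G) y u v w = fderiv ℝ (christoffel G) y u w v := by
  have hd := differentiableAt_of_contDiffOn h.isOpen h.contDiffOn_christoffel hy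
  have h1 : ∀ a b : E, fderiv ℝ (fun z => christoffel G z a b) y u =
      fderiv ℝ (christoffel G) y u a b := fun a b => by
    rw [fderiv_bilin_apply_eq hd (differentiableAt_const a) (differentiableAt_const b)]; simp
  rw [← h1, ← h1, fderiv_eq_of_eqOn h.isOpen (fun z hz => h.christoffel_symm hz v w) hy]

theorem bianchi_first (u v w : E) :
    curvature G y u v w + curvature G y v w u + curvature G y w u v = 0 := by
  simp only [curvature_apply]
  rw [h.fderiv_christoffel_symm hy u w v, h.fderiv_christoffel_symm hy v w u,
    h.fderiv_christoffel_symm hy w v u, h.christoffel_symm hy w v, h.christoffel_symm hy u w,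
    h.christoffel_symm hy v u]
  abel

/-- The Ricci identity for the parallel tensor G: second derivatives of G commute, and each is
expressed through Γ by differentiating metric compatibility. -/
theorem inner_curvature_skew (u v a b : E) :
    G y (curvature G y u v a) b = - G y (curvature G y u v b) a := by
  have hG := differentiableAt_of_contDiffOn h.isOpen h.smooth hy
  have hD := differentiableAt_of_contDiffOn h.isOpen (contDiffOn_fderiv h.isOpen h.smooth) hy
  have hC := differentiableAt_of_contDiffOn h.isOpen h.contDiffOn_christoffel hy
  have key : ∀ u v : E, fderiv ℝ (fderiv ℝ G) y u v a b =
      G y (christoffel G y u (christoffel G y v a)) b +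
      G y (christoffel G y v a) (christoffel G y u b) +
      G y (fderiv ℝ (christoffel G) y u v a) b +
      (G y (christoffel G y u a) (christoffel G y v b) +
      G y a (christoffel G y u (christoffel G y v b)) +
      G y a (fderiv ℝ (christoffel G) y u v b)) := by
    intro u v
    have hCc : ∀ c, DifferentiableAt ℝ (fun z => christoffel G z v c) y := fun c => by fun_prop
    have e1 : fderiv ℝ (fun z => fderiv ℝ G z v a b) y u = fderiv ℝ (fderiv ℝ G) y u v a b := by
      rw [fderiv_bilin_apply_eq (hD.clm_apply (differentiableAt_const v))
        (differentiableAt_const a) (differentiableAt_const b), fderiv_clm_apply_const hD]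
      simp
    have hc : ∀ c, fderiv ℝ (fun z => christoffel G z v c) y u =
        fderiv ℝ (christoffel G) y u v c := fun c => by
      rw [fderiv_bilin_apply_eq hC (differentiableAt_const v) (differentiableAt_const c)]; simp
    rw [← e1, fderiv_eq_of_eqOn h.isOpen (fun z hz => h.fderiv_eq hz v a b) hy,
      fderiv_fun_add (by fun_prop) (by fun_prop), add_apply,
      fderiv_bilin_apply_eq hG (hCc a) (differentiableAt_const b),
      fderiv_bilin_apply_eq hG (differentiableAt_const a) (hCc b), hc, hc,
      h.fderiv_eq hy, h.fderiv_eq hy]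
    simp
  have e := fderiv_fderiv_comm h.isOpen h.smooth hy u v
  have e' := key u v
  rw [e, key v u] at e'
  rw [h.symm y hy (curvature G y u v b)]
  simp only [curvature_apply, map_add, map_sub, add_apply,
    sub_apply]
  linarith

/-- Pair symmetry of the Riemann tensor. -/
theorem inner_curvature_pair (u v a b : E) :
    G y (curvature G y u v a) b = G y (curvature G y a b u) v := by
  have B : ∀ u v a b : E, G y (curvature G y u v a) b + G y (curvature G y v a u) b +
      G y (curvature G y a u v) b = 0 := fun u v a b => by
    have := congrArg (fun x => G y x b) (h.bianchi_first hy u v a)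
    simpa using this
  have S := h.inner_curvature_skew hy
  have N : ∀ u v a b : E, G y (curvature G y u v a) b = - G y (curvature G y v u a) b :=
    fun u v a b => by rw [curvature_antisymm]; simp
  -- The classical octahedron argument: a combination of four first Bianchi identities, modulo the
  -- two skew-symmetries.
  linarith [B u v a b, B v a b u, B a b u v, B b u v a, S u v a b, S v a u b, S a u v b,
    S v a b u, S a b v u, S b v a u, S a b u v, S b u a v, S u a b v, S b u v a, S u v b a,
    S v b u a, N u v a b, N v a u b, N a u v b, N a b u v, N b u a v, N v b u a, N u v b a,
    N a b v u, N v a b u, N b u v a, N u a b v, N b v a u]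

theorem fderiv_curvature (u v w x : E) : fderiv ℝ (curvature G) y u v w x =
    fderiv ℝ (fderiv ℝ (christoffel G)) y u v w x - fderiv ℝ (fderiv ℝ (christoffel G)) y u w v x
    + fderiv ℝ (christoffel G) y u v (christoffel G y w x)
    + christoffel G y v (fderiv ℝ (christoffel G) y u w x)
    - fderiv ℝ (christoffel G) y u w (christoffel G y v x)
    - christoffel G y w (fderiv ℝ (christoffel G) y u v x) := by
  have hC := differentiableAt_of_contDiffOn h.isOpen h.contDiffOn_christoffel hy
  have hD := differentiableAt_of_contDiffOn h.isOpen
    (contDiffOn_fderiv h.isOpen h.contDiffOn_christoffel) hy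
  have hR := differentiableAt_of_contDiffOn h.isOpen h.contDiffOn_curvature hy
  have e1 : ∀ v w, fderiv ℝ (fun z => fderiv ℝ (christoffel G) z v w x) y u =
      fderiv ℝ (fderiv ℝ (christoffel G)) y u v w x := fun v w => by
    rw [fderiv_bilin_apply_eq (hD.clm_apply (differentiableAt_const v))
      (differentiableAt_const w) (differentiableAt_const x), fderiv_clm_apply_const hD]
    simp
  have e2 : ∀ v w, fderiv ℝ (fun z => christoffel G z v (christoffel G z w x)) y u =
      fderiv ℝ (christoffel G) y u v (christoffel G y w x)
      + christoffel G y v (fderiv ℝ (christoffel G) y u w x) := fun v w => by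
    rw [fderiv_bilin_apply_eq hC (differentiableAt_const v) (by fun_prop),
      fderiv_bilin_apply_eq hC (differentiableAt_const w) (differentiableAt_const x)]
    simp
  have e3 : fderiv ℝ (fun z => curvature G z v w x) y u = fderiv ℝ (curvature G) y u v w x := by
    rw [fderiv_bilin_apply_eq (hR.clm_apply (differentiableAt_const v))
      (differentiableAt_const w) (differentiableAt_const x), fderiv_clm_apply_const hR]
    simp
  rw [← e3]
  simp only [curvature_apply]
  rw [fderiv_fun_sub (by fun_prop) (by fun_prop), fderiv_fun_add (by fun_prop) (by fun_prop),
    fderiv_fun_sub (by fun_prop) (by fun_prop)]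
  simp only [add_apply, sub_apply, e1, e2]
  abel

/-- Second Bianchi identity, in the form `∑ ∂_u R(v, w) + [Γ_u, R(v, w)] = 0` (cyclic sum). -/
theorem bianchi_second (u v w x : E) :
    (fderiv ℝ (curvature G) y u v w x + christoffel G y u (curvature G y v w x)
      - curvature G y v w (christoffel G y u x))
    + (fderiv ℝ (curvature G) y v w u x + christoffel G y v (curvature G y w u x)
      - curvature G y w u (christoffel G y v x))
    + (fderiv ℝ (curvature G) y w u v x + christoffel G y w (curvature G y u v x)
      - curvature G y u v (christoffel G y w x)) = 0 := by
  have c := fderiv_fderiv_comm h.isOpen h.contDiffOn_christoffel hy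
  simp only [h.fderiv_curvature hy, curvature_apply, map_add, map_sub]
  rw [c v u, c w v, c u w]
  abel

end IsMetricOn

end LocalRiem

/-! ### Pointwise algebra of weak metric f-structures -/

namespace LocalRiem

variable {E : Type*} [NormedAddCommGroup E] [NormedSpace ℝ E] {ι : Type*} [Fintype ι]
  [DecidableEq ι]

/-- The pointwise axioms of a weak metric `f`-structure, on a single vector space. -/
structure IsWeakMetricF (f Q : E →L[ℝ] E) (ξ : ι → E) (η : ι → E →L[ℝ] ℝ)
    (g : E →L[ℝ] E →L[ℝ] ℝ) : Prop where
  nonsingular : Function.Bijective Q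
  f_cubed : ∀ X, f (f (f X)) + f (Q X) = 0
  f_squared : ∀ X, f (f X) = -(Q X) + ∑ i, η i X • ξ i
  eta_xi : ∀ i j, η i (ξ j) = if i = j then 1 else 0
  Q_xi : ∀ i, Q (ξ i) = ξ i
  f_invariant : ∀ X, (∀ i, η i X = 0) → ∀ i, η i (f X) = 0
  compatible : ∀ X Y, g (f X) (f Y) = g X (Q Y) - ∑ i, η i X * η i Y
  symm : ∀ X Y, g X Y = g Y X

namespace IsWeakMetricF

variable {f Q : E →L[ℝ] E} {ξ : ι → E} {η : ι → E →L[ℝ] ℝ} {g : E →L[ℝ] E →L[ℝ] ℝ}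
  (h : IsWeakMetricF f Q ξ η g)
include h

theorem f_xi (i : ι) : f (ξ i) = 0 := by
  have h2 : f (f (ξ i)) = 0 := by
    rw [h.f_squared, h.Q_xi]
    simp [h.eta_xi]
  simpa [h2, h.Q_xi] using h.f_cubed (ξ i)

/-- Subtracting the vertical part of X, which f kills, reduces the claim to the f-invariance of the
contact distribution. -/
theorem eta_f (i : ι) (X : E) : η i (f X) = 0 := by
  have h1 := h.f_invariant (X - ∑ j, η j X • ξ j) (fun i => by simp [h.eta_xi]) i
  simpa [h.f_xi] using h1

theorem eta_eq (i : ι) (X : E) : η i X = g (ξ i) X := by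
  have h1 := h.compatible X (ξ i)
  simp only [h.f_xi, map_zero, h.Q_xi, h.eta_xi, mul_ite, mul_one, mul_zero,
    Finset.sum_ite_eq', Finset.mem_univ, if_true] at h1
  rw [h.symm]
  linarith

/-- If f X = 0, the formula for f² gives Q X = ∑ η^i(X) ξ_i. As Q fixes each ξ_i and is injective, X
is that same sum. -/
theorem eq_sum_of_f_eq_zero {X : E} (hX : f X = 0) : X = ∑ i, η i X • ξ i := by
  apply h.nonsingular.1
  have h2 := h.f_squared X
  rw [hX, map_zero, eq_comm, neg_add_eq_zero] at h2
  rw [h2, map_sum]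
  simp [h.Q_xi]

theorem f_Q (X : E) : f (Q X) = Q (f X) := by
  have h1 := h.f_cubed X
  have h2 := h.f_squared (f X)
  simp only [h.eta_f, zero_smul, Finset.sum_const_zero, add_zero] at h2
  rw [h2] at h1
  exact (neg_add_eq_zero.1 h1).symm

/-- Compatibility only controls g(f X, f Y). Writing Y = Q Z turns Y into -f²Z up to a vertical
vector, which is orthogonal to f X. -/
theorem f_skew (X Y : E) : g (f X) Y = - g X (f Y) := by
  obtain ⟨Z, rfl⟩ := h.nonsingular.2 Y
  have h1 := h.compatible X (f Z)
  have h2 : g (f X) (f (f Z)) = - g (f X) (Q Z) := by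
    have : ∀ i, g (f X) (ξ i) = 0 := fun i => by rw [h.symm, ← h.eta_eq, h.eta_f]
    simp [h.f_squared, this]
  simp only [h.eta_f, mul_zero, Finset.sum_const_zero, sub_zero] at h1
  rw [h.f_Q]
  linarith

theorem f_squared_symm (X Y : E) : g (f (f X)) Y = g (f (f Y)) X := by
  rw [h.f_skew, h.f_skew, neg_neg, h.symm]

end IsWeakMetricF

/-- An orthonormal family of fields `ξ` with `∇_u ξ_j = β (u - ∑ g(ξ_k, u) ξ_k)` for a metric `G`
on `U`. -/
structure IsKenmotsuFrame (G : E → E →L[ℝ] E →L[ℝ] ℝ) (U : Set E) (ξ : ι → E → E) (β : ℝ) :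
    Prop extends IsMetricOn G U where
  smooth_xi : ∀ k, ContDiffOn ℝ ∞ (ξ k) U
  orthonormal : ∀ y ∈ U, ∀ j k, G y (ξ j y) (ξ k y) = if j = k then 1 else 0
  nabla_xi : ∀ y ∈ U, ∀ j u, fderiv ℝ (ξ j) y u + christoffel G y u (ξ j y) =
    β • (u - ∑ k, G y (ξ k y) u • ξ k y)

/-! ### From normality and the formula for ∇f to ∇ξ -/

section Normality

variable [FiniteDimensional ℝ E] {G : E → E →L[ℝ] E →L[ℝ] ℝ} {U : Set E} {f Q : E → E →L[ℝ] E}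
  {ξ : ι → E → E} {η : ι → E → E →L[ℝ] ℝ} {y : E}

omit [FiniteDimensional ℝ E] in
theorem nijenhuis_const (hf : DifferentiableAt ℝ f y) (u v : E) :
    nijenhuis f (fun _ => u) (fun _ => v) y = fderiv ℝ f y (f y u) v - fderiv ℝ f y (f y v) u
      + f y (fderiv ℝ f y v u) - f y (fderiv ℝ f y u v) := by
  have h1 : ∀ a b : E, fderiv ℝ (fun z => f z a) y b = fderiv ℝ f y b a :=
    fun a b => fderiv_clm_apply_const hf a b
  simp only [nijenhuis, VectorField.lieBracket, h1, fderiv_fun_const]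
  simp only [Pi.zero_apply, zero_apply, sub_zero, zero_sub, map_zero, map_neg, zero_add,
    sub_neg_eq_add]

/-- For a torsion-free connection the Nijenhuis torsion can be computed with `∇` in place of `∂`. -/
theorem nijenhuis_const_eq_covDeriv (h : IsMetricOn G U) (hy : y ∈ U)
    (hf : DifferentiableAt ℝ f y) (u v : E) :
    nijenhuis f (fun _ => u) (fun _ => v) y =
      covDerivEndo G f y (f y u) v - covDerivEndo G f y (f y v) u
      + f y (covDerivEndo G f y v u) - f y (covDerivEndo G f y u v) := by
  simp only [nijenhuis_const hf, covDerivEndo_apply, map_add, map_sub]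
  rw [h.christoffel_symm hy (f y v) (f y u), h.christoffel_symm hy v u,
    h.christoffel_symm hy (f y u) v, h.christoffel_symm hy (f y v) u]
  abel

theorem fderiv_inner_eq (h : IsMetricOn G U) (hy : y ∈ U) {X : E → E}
    (hX : DifferentiableAt ℝ X y) (u v : E) :
    fderiv ℝ (fun z => G z (X z) v) y u =
      G y (fderiv ℝ X y u + christoffel G y u (X y)) v + G y (X y) (christoffel G y u v) := by
  rw [fderiv_bilin_apply_eq (differentiableAt_of_contDiffOn h.isOpen h.smooth hy) hX
    (differentiableAt_const v), h.fderiv_eq hy]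
  simp
  ring

/-- On a normal structure with the Kenmotsu condition on `∇ f`, the forms `η^k` are closed. -/
theorem inner_nabla_xi_symm (h : IsMetricOn G U) (hξ : ∀ k, ContDiffOn ℝ ∞ (ξ k) U)
    (hf : ContDiffOn ℝ ∞ f U)
    (hS : ∀ z ∈ U, IsWeakMetricF (f z) (Q z) (fun k => ξ k z) (fun k => η k z) (G z)) {β : ℝ}
    (hy : y ∈ U)
    (hN : ∀ u v : E, nijenhuis f (fun _ => u) (fun _ => v) y +
      ∑ k, (2 * extDerivOneForm (η k) (fun _ => u) (fun _ => v) y) • ξ k y = 0)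
    (hK : ∀ u v : E, covDerivEndo G f y u v =
      β • (G y (f y u) v • ∑ k, ξ k y - (∑ k, η k y v) • f y u)) (k : ι) (u v : E) :
    G y (fderiv ℝ (ξ k) y u + christoffel G y u (ξ k y)) v =
      G y (fderiv ℝ (ξ k) y v + christoffel G y v (ξ k y)) u := by
  have S := hS y hy
  -- In the expression through ∇f, the η̄ terms cancel in pairs and the ξ̄ terms cancel because f²
  -- is self-adjoint.
  have hnij : nijenhuis f (fun _ => u) (fun _ => v) y = 0 := by
    rw [nijenhuis_const_eq_covDeriv h hy (differentiableAt_of_contDiffOn h.isOpen hf hy)]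
    simp only [hK, map_smul, map_sub, map_sum, S.f_xi, Finset.sum_const_zero, smul_zero,
      S.f_squared_symm u v]
    module
  have hη : ∀ j (a b : E), fderiv ℝ (fun z => η j z a) y b =
      G y (fderiv ℝ (ξ j) y b + christoffel G y b (ξ j y)) a + G y (ξ j y) (christoffel G y b a) :=
    fun j a b => by
      rw [fderiv_eq_of_eqOn (B := fun z => G z (ξ j z) a) h.isOpen
        (fun z hz => (hS z hz).eta_eq j a) hy,
        fderiv_inner_eq h hy (differentiableAt_of_contDiffOn h.isOpen (hξ j) hy)]
  -- Applying η^k isolates dη^k(u,v), now zero; for constant fields the bracket vanishes as well.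
  have h0 := congrArg (η k y) (hN u v)
  rw [hnij] at h0
  simp only [zero_add, map_sum, map_smul, S.eta_xi, smul_eq_mul, mul_ite, mul_one, mul_zero,
    Finset.sum_ite_eq, Finset.mem_univ, if_true, map_zero, extDerivOneForm, hη,
    VectorField.lieBracket, fderiv_fun_const] at h0
  simp only [Pi.zero_apply, zero_apply, sub_zero, map_zero] at h0
  rw [h.christoffel_symm hy v u] at h0
  linarith

/-- A weak `β`-Kenmotsu `f`-structure satisfies `∇_u ξ_j = β (u - ∑ η^k(u) ξ_k)`. -/
theorem isKenmotsuFrame_of_normal (h : IsMetricOn G U) (hξ : ∀ k, ContDiffOn ℝ ∞ (ξ k) U)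
    (hf : ContDiffOn ℝ ∞ f U)
    (hS : ∀ z ∈ U, IsWeakMetricF (f z) (Q z) (fun k => ξ k z) (fun k => η k z) (G z)) {β : ℝ}
    (hN : ∀ z ∈ U, ∀ u v : E, nijenhuis f (fun _ => u) (fun _ => v) z +
      ∑ k, (2 * extDerivOneForm (η k) (fun _ => u) (fun _ => v) z) • ξ k z = 0)
    (hK : ∀ z ∈ U, ∀ u v : E, covDerivEndo G f z u v =
      β • (G z (f z u) v • ∑ k, ξ k z - (∑ k, η k z v) • f z u)) :
    IsKenmotsuFrame G U ξ β where
  toIsMetricOn := h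
  smooth_xi := hξ
  orthonormal y hy j k := by rw [← (hS y hy).eta_eq, (hS y hy).eta_xi]
  nabla_xi y hy j u := by
    have S := hS y hy
    have hfd := differentiableAt_of_contDiffOn h.isOpen hf hy
    have hξd := fun k => differentiableAt_of_contDiffOn h.isOpen (hξ k) hy
    have hGd := differentiableAt_of_contDiffOn h.isOpen h.smooth hy
    set N : E → ι → E := fun u j => fderiv ℝ (ξ j) y u + christoffel G y u (ξ j y) with hNdef
    -- Differentiating f ξ_j = 0 gives f(∇_u ξ_j) = -(∇_u f) ξ_j = β f u.
    have hfN : ∀ u j, f y (N u j - β • u) = 0 := by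
      intro u j
      have h1 : fderiv ℝ (fun z => f z (ξ j z)) y u = 0 := by
        rw [fderiv_eq_of_eqOn (B := fun _ => 0) h.isOpen (fun z hz => (hS z hz).f_xi j) hy]
        simp
      rw [fderiv_clm_apply_eq hfd (hξd j)] at h1
      have h2 := hK y hy u (ξ j y)
      have h3 : G y (f y u) (ξ j y) = 0 := by rw [S.symm, ← S.eta_eq, S.eta_f]
      simp only [covDerivEndo_apply, S.f_xi, map_zero, add_zero, h3, zero_smul, zero_sub,
        S.eta_xi, Finset.sum_ite_eq', Finset.mem_univ, if_true, one_smul] at h2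
      have h4 : f y (N u j - β • u) = (fderiv ℝ f y u (ξ j y) + f y (fderiv ℝ (ξ j) y u))
          - (fderiv ℝ f y u (ξ j y) - f y (christoffel G y u (ξ j y))) - β • f y u := by
        simp only [hNdef, map_sub, map_add, map_smul]
        abel
      rw [h4, h1, h2]
      module
    have hN' : ∀ u j, N u j = β • u + ∑ k, (G y (N u j) (ξ k y) - β * G y (ξ k y) u) • ξ k y := by
      intro u j
      have h1 := S.eq_sum_of_f_eq_zero (hfN u j)
      rw [sub_eq_iff_eq_add'] at h1
      rw [h1]
      congr 1
      refine Finset.sum_congr rfl fun k _ => ?_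
      rw [← h1, S.eta_eq, map_sub, map_smul, S.symm (N u j), smul_eq_mul]
    have hsymm : ∀ k u v, G y (N u k) v = G y (N v k) u :=
      inner_nabla_xi_symm h hξ hf hS hy (hN y hy) (hK y hy)
    have hskew : ∀ u j k, G y (N u j) (ξ k y) + G y (N u k) (ξ j y) = 0 := by
      intro u j k
      have h1 : fderiv ℝ (fun z => G z (ξ j z) (ξ k z)) y u = 0 := by
        rw [fderiv_eq_of_eqOn (B := fun _ => if j = k then 1 else 0) h.isOpen
          (fun z hz => by rw [← (hS z hz).eta_eq, (hS z hz).eta_xi]) hy]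
        simp
      rw [fderiv_bilin_apply_eq hGd (hξd j) (hξd k), h.fderiv_eq hy] at h1
      simp only [hNdef, map_add, add_apply]
      rw [S.symm (fderiv ℝ (ξ k) y u), S.symm (christoffel G y u (ξ k y))]
      linarith
    -- The array g(∇_{ξ_l} ξ_j, ξ_k) is symmetric in l, k and skew in j, k, hence zero.
    have hvert : ∀ l j k, G y (N (ξ l y) j) (ξ k y) = 0 := by
      intro l j k
      linarith [hsymm j (ξ l y) (ξ k y), hskew (ξ k y) j l, hsymm l (ξ k y) (ξ j y),
        hskew (ξ j y) l k, hsymm k (ξ j y) (ξ l y), hskew (ξ l y) k j]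
    have hNxi : ∀ l j, N (ξ l y) j = 0 := by
      intro l j
      rw [hN' (ξ l y) j]
      simp only [hvert, ← S.eta_eq, S.eta_xi, mul_ite, mul_one, mul_zero, zero_sub, neg_smul,
        ite_smul, zero_smul, Finset.sum_neg_distrib, Finset.sum_ite_eq',
        Finset.mem_univ, if_true, add_neg_cancel]
    -- Closedness of η^j moves ξ_k into the differentiation slot, where ∇_{ξ_k} ξ_j = 0.
    have hzero : ∀ k, G y (N u j) (ξ k y) = 0 := fun k => by
      rw [hsymm, hNxi]; simp
    change N u j = _
    rw [hN' u j]
    simp only [hzero, zero_sub, neg_smul, Finset.sum_neg_distrib, smul_sub, Finset.smul_sum,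
      mul_smul, ← sub_eq_add_neg]

end Normality

end LocalRiem

/-! ### Curvature of a Kenmotsu frame -/

namespace LocalRiem

variable {E : Type*} [NormedAddCommGroup E] [NormedSpace ℝ E] {ι : Type*} [Fintype ι]

/-- The field of projections `v ↦ v - ∑ G(ξ_k, v) ξ_k` along the span of the fields `ξ_k`. -/
noncomputable def horizontalProj (G : E → E →L[ℝ] E →L[ℝ] ℝ) (ξ : ι → E → E) (y : E) : E →L[ℝ] E :=
  ContinuousLinearMap.id ℝ E - ∑ k, (G y (ξ k y)).smulRight (ξ k y)

theorem horizontalProj_apply (G : E → E →L[ℝ] E →L[ℝ] ℝ) (ξ : ι → E → E) (y v : E) :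
    horizontalProj G ξ y v = v - ∑ k, G y (ξ k y) v • ξ k y := by
  simp [horizontalProj]

theorem traceCLM_smulRight [FiniteDimensional ℝ E] (φ : E →L[ℝ] ℝ) (x : E) :
    traceCLM E (φ.smulRight x) = φ x :=
  LinearMap.trace_smulRight φ.toLinearMap x

theorem traceCLM_id [FiniteDimensional ℝ E] :
    traceCLM E (ContinuousLinearMap.id ℝ E) = Module.finrank ℝ E :=
  LinearMap.trace_id ℝ E

theorem traceCLM_comp_comm [FiniteDimensional ℝ E] (A B : E →L[ℝ] E) :
    traceCLM E (A ∘L B) = traceCLM E (B ∘L A) :=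
  LinearMap.trace_comp_comm' B.toLinearMap A.toLinearMap

namespace IsKenmotsuFrame

variable [DecidableEq ι] {G : E → E →L[ℝ] E →L[ℝ] ℝ} {U : Set E} {ξ : ι → E → E} {β : ℝ}
  (h : IsKenmotsuFrame G U ξ β) {y : E} (hy : y ∈ U)
include h hy

local notation "P" => horizontalProj G ξ

theorem differentiableAt_metric : DifferentiableAt ℝ G y :=
  differentiableAt_of_contDiffOn h.isOpen h.smooth hy

theorem differentiableAt_xi (k : ι) : DifferentiableAt ℝ (ξ k) y :=
  differentiableAt_of_contDiffOn h.isOpen (h.smooth_xi k) hy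

theorem differentiableAt_proj_apply (v : E) : DifferentiableAt ℝ (fun z => P z v) y := by
  have h1 := h.differentiableAt_metric hy
  have h2 := fun k => h.differentiableAt_xi hy k
  simp only [horizontalProj_apply]
  fun_prop

theorem inner_xi_proj (k : ι) (v : E) : G y (ξ k y) (P y v) = 0 := by
  simp [horizontalProj_apply, h.orthonormal y hy]

theorem inner_proj_xi (k : ι) (v : E) : G y (P y v) (ξ k y) = 0 := by
  rw [h.symm y hy, h.inner_xi_proj hy]

omit [DecidableEq ι] h hy in
theorem inner_proj_left (u v : E) :
    G y (P y u) v = G y u v - ∑ k, G y (ξ k y) u * G y (ξ k y) v := by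
  simp [horizontalProj_apply]

theorem inner_proj_symm (u v : E) : G y (P y u) v = G y (P y v) u := by
  rw [inner_proj_left, inner_proj_left, h.symm y hy]
  simp only [mul_comm]

theorem inner_proj_right (u v : E) : G y u (P y v) = G y (P y u) v := by
  rw [h.symm y hy, h.inner_proj_symm hy]

theorem proj_proj (u : E) : P y (P y u) = P y u := by
  rw [horizontalProj_apply G ξ y (P y u)]
  simp [h.inner_xi_proj hy]

theorem inner_sum_xi (j : ι) : G y (∑ k, ξ k y) (ξ j y) = 1 := by
  simp [h.orthonormal y hy]

theorem inner_sum_xi_sum_xi : G y (∑ k, ξ k y) (∑ k, ξ k y) = Fintype.card ι := by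
  simp [h.orthonormal y hy]

theorem fderiv_xi (j : ι) (u : E) :
    fderiv ℝ (ξ j) y u = β • P y u - christoffel G y u (ξ j y) := by
  rw [horizontalProj_apply, ← h.nabla_xi y hy, add_sub_cancel_right]

theorem fderiv_sum_xi (u : E) : fderiv ℝ (fun z => ∑ j, ξ j z) y u =
    ((Fintype.card ι : ℝ) * β) • P y u - christoffel G y u (∑ j, ξ j y) := by
  rw [fderiv_fun_sum fun j _ => h.differentiableAt_xi hy j]
  simp [h.fderiv_xi hy, Finset.sum_sub_distrib, mul_smul, Nat.cast_smul_eq_nsmul]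

variable [FiniteDimensional ℝ E]

theorem fderiv_inner_xi (j : ι) (u v : E) : fderiv ℝ (fun z => G z (ξ j z) v) y u =
    β * G y (P y u) v + G y (ξ j y) (christoffel G y u v) := by
  rw [fderiv_inner_eq h.toIsMetricOn hy (h.differentiableAt_xi hy j), h.fderiv_xi hy]
  simp

theorem fderiv_inner_sum_xi (u v : E) : fderiv ℝ (fun z => G z (∑ j, ξ j z) v) y u =
    (Fintype.card ι : ℝ) * β * G y (P y u) v + G y (∑ j, ξ j y) (christoffel G y u v) := by
  rw [fderiv_inner_eq h.toIsMetricOn hy (X := fun z => ∑ j, ξ j z)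
    (DifferentiableAt.fun_sum fun j _ => h.differentiableAt_xi hy j), h.fderiv_sum_xi hy]
  simp

/-- `(∇_u P) v = -β (g(P u, v) ξ̄ + η̄(v) P u)`. -/
theorem fderiv_proj (u v : E) : fderiv ℝ (fun z => P z v) y u =
    -β • (G y (P y u) v • (∑ k, ξ k y) + G y (∑ k, ξ k y) v • P y u)
    - christoffel G y u (P y v) + P y (christoffel G y u v) := by
  have h1 := h.differentiableAt_metric hy
  have h2 := fun k => h.differentiableAt_xi hy k
  have e : ∀ k, fderiv ℝ (fun z => G z (ξ k z) v • ξ k z) y u =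
      (β * G y (P y u) v + G y (ξ k y) (christoffel G y u v)) • ξ k y +
      (β • G y (ξ k y) v • P y u - G y (ξ k y) v • christoffel G y u (ξ k y)) := fun k => by
    rw [fderiv_fun_smul (by fun_prop) (h2 k)]
    simp only [add_apply, smul_apply, ContinuousLinearMap.smulRight_apply, h.fderiv_xi hy,
      h.fderiv_inner_xi hy]
    module
  simp only [horizontalProj_apply G ξ _ v]
  rw [fderiv_fun_sub (by fun_prop) (by fun_prop), fderiv_fun_sum (fun k _ => by fun_prop)]
  rw [fderiv_fun_const, horizontalProj_apply G ξ y (christoffel G y u v)]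
  simp only [Pi.zero_apply, zero_sub, neg_apply, sum_apply, e, map_sub, map_sum, map_smul,
    add_smul, smul_add, Finset.sum_add_distrib, Finset.sum_sub_distrib,
    Finset.smul_sum, Finset.sum_smul, mul_smul, neg_smul,
    Finset.sum_neg_distrib]
  abel

/-- `R(u, v) ξ_j = β² (η̄(u) P v - η̄(v) P u)`. -/
theorem curvature_xi (j : ι) (u v : E) : curvature G y u v (ξ j y) =
    β ^ 2 • (G y (∑ k, ξ k y) u • P y v - G y (∑ k, ξ k y) v • P y u) := by
  have hξ := h.differentiableAt_xi hy j
  have hξ' := differentiableAt_of_contDiffOn h.isOpen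
    (contDiffOn_fderiv h.isOpen (h.smooth_xi j)) hy
  have hC := differentiableAt_of_contDiffOn h.isOpen h.contDiffOn_christoffel hy
  -- The equation ∂_v ξ_j = β P v - Γ(v, ξ_j) holds on all of U, so it can be differentiated again;
  -- symmetry in u, v then yields the curvature.
  have key : ∀ u v, fderiv ℝ (fderiv ℝ (ξ j)) y u v =
      β • fderiv ℝ (fun z => P z v) y u - (fderiv ℝ (christoffel G) y u v (ξ j y) +
      christoffel G y v (β • P y u - christoffel G y u (ξ j y))) := by
    intro u v
    rw [← fderiv_clm_apply_const hξ', fderiv_eq_of_eqOn h.isOpen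
      (fun z hz => h.fderiv_xi hz j v) hy, fderiv_fun_sub
      ((h.differentiableAt_proj_apply hy v).fun_const_smul β) (by fun_prop),
      fderiv_fun_const_smul (h.differentiableAt_proj_apply hy v)]
    rw [sub_apply, fderiv_bilin_apply_eq hC (differentiableAt_const v) hξ, h.fderiv_xi hy]
    simp
  have e := fderiv_fderiv_comm h.isOpen (h.smooth_xi j) hy u v
  rw [key u v, key v u, h.fderiv_proj hy, h.fderiv_proj hy, h.christoffel_symm hy v u,
    h.inner_proj_symm hy v u] at e
  rw [curvature_apply, ← sub_eq_zero]
  rw [← sub_eq_zero] at e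
  simp only [map_sub, map_smul] at e
  rw [← neg_eq_zero, ← e]
  module

/-- `R(v, ξ_j) z = β² (g(P z, v) ξ̄ - η̄(z) P v)`. -/
theorem curvature_xi_right (j : ι) (v z : E) : curvature G y v (ξ j y) z =
    β ^ 2 • (G y (P y z) v • (∑ k, ξ k y) - G y (∑ k, ξ k y) z • P y v) := by
  -- Pair symmetry and skewness give g(R(v,ξ_j)z, w) = -g(R(z,w)ξ_j, v), which is already known.
  refine h.eq_of_inner_eq hy fun w => ?_
  rw [h.inner_curvature_pair hy, h.inner_curvature_skew hy, h.curvature_xi hy]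
  simp only [map_smul, map_sub, smul_apply, sub_apply, smul_eq_mul]
  rw [h.inner_proj_symm hy w v]
  ring

/-- Product rule for the explicit field R(v,ξ_j)z. Differentiating the argument ξ_j leaves the one
term that is not explicit, -β R(v,Pu)z, which brings R back into ∇_{ξ_j}R. -/
theorem fderiv_curvature_xi_right (j : ι) (u v z : E) :
    fderiv ℝ (curvature G) y u v (ξ j y) z =
      β ^ 2 • ((G y (christoffel G y u (P y z)) v + G y (P y z) (christoffel G y u v) +
        G y (fderiv ℝ (fun z' => P z' z) y u) v) • (∑ k, ξ k y)
        + G y (P y z) v • (((Fintype.card ι : ℝ) * β) • P y u - christoffel G y u (∑ j, ξ j y))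
        - ((Fintype.card ι : ℝ) * β * G y (P y u) z +
          G y (∑ j, ξ j y) (christoffel G y u z)) • P y v
        - G y (∑ k, ξ k y) z • fderiv ℝ (fun z' => P z' v) y u)
      - curvature G y v (β • P y u - christoffel G y u (ξ j y)) z := by
  have hξ := h.differentiableAt_xi hy
  have hG := h.differentiableAt_metric hy
  have hP := h.differentiableAt_proj_apply hy
  have hR := differentiableAt_of_contDiffOn h.isOpen h.contDiffOn_curvature hy
  have e1 : fderiv ℝ (fun x => curvature G x v (ξ j x) z) y u =
      fderiv ℝ (curvature G) y u v (ξ j y) z + curvature G y v (fderiv ℝ (ξ j) y u) z := by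
    rw [fderiv_bilin_apply_eq (hR.clm_apply (differentiableAt_const v)) (hξ j)
      (differentiableAt_const z), fderiv_clm_apply_const hR]
    simp
  have e2 : fderiv ℝ (fun x => G x (P x z) v) y u = G y (christoffel G y u (P y z)) v +
      G y (P y z) (christoffel G y u v) + G y (fderiv ℝ (fun z' => P z' z) y u) v := by
    rw [fderiv_inner_eq h.toIsMetricOn hy (hP z)]
    simp
    ring
  rw [← h.fderiv_xi hy, eq_sub_iff_add_eq, ← e1, fderiv_eq_of_eqOn h.isOpen
    (fun x hx => h.curvature_xi_right hx j v z) hy,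
    fderiv_fun_const_smul (by fun_prop), fderiv_fun_sub (by fun_prop) (by fun_prop),
    fderiv_fun_smul (by fun_prop) (by fun_prop), fderiv_fun_smul (by fun_prop) (by fun_prop)]
  simp only [smul_apply, sub_apply, add_apply, ContinuousLinearMap.smulRight_apply, e2,
    h.fderiv_sum_xi hy, h.fderiv_inner_sum_xi hy]
  module

theorem fderiv_curvature_antisymm (u v w x : E) :
    fderiv ℝ (curvature G) y u v w x = - fderiv ℝ (curvature G) y u w v x := by
  rw [h.fderiv_curvature hy, h.fderiv_curvature hy]
  abel

/-- The covariant derivative of the curvature tensor along `ξ_j`. -/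
theorem covDeriv_curvature_xi (j : ι) (u v z : E) :
    fderiv ℝ (curvature G) y (ξ j y) u v z + christoffel G y (ξ j y) (curvature G y u v z)
      - curvature G y u v (christoffel G y (ξ j y) z)
      - curvature G y (christoffel G y (ξ j y) u) v z
      - curvature G y u (christoffel G y (ξ j y) v) z =
    β • (curvature G y v (P y u) z - curvature G y u (P y v) z)
      - β ^ 3 • ((G y (P y v) z * G y (∑ k, ξ k y) u - G y (P y u) z * G y (∑ k, ξ k y) v) •
          (∑ k, ξ k y)
        + (2 * (Fintype.card ι : ℝ)) • (G y (P y z) v • P y u - G y (P y z) u • P y v)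
        + G y (∑ k, ξ k y) z • (G y (∑ k, ξ k y) v • P y u - G y (∑ k, ξ k y) u • P y v)) := by
  -- The other two cyclic terms contain ξ_j as an argument of R, so the preceding formulas evaluate
  -- them. The Γ corrections for u and v match by symmetry of Γ.
  have B := h.bianchi_second hy (ξ j y) u v z
  rw [h.fderiv_curvature_antisymm hy v (ξ j y) u, h.fderiv_curvature_xi_right hy,
    h.fderiv_curvature_xi_right hy, curvature_antisymm G y (ξ j y) u,
    curvature_antisymm G y (ξ j y) u (christoffel G y v z),
    h.curvature_xi_right hy, h.curvature_xi_right hy, h.curvature_xi_right hy,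
    h.curvature_xi_right hy, h.fderiv_proj hy, h.fderiv_proj hy, h.fderiv_proj hy,
    h.fderiv_proj hy] at B
  rw [curvature_antisymm G y (christoffel G y (ξ j y) u) v, h.christoffel_symm hy (ξ j y) u,
    h.christoffel_symm hy (ξ j y) v, ← sub_eq_zero, ← B]
  rw [h.christoffel_symm hy v u]
  simp only [map_add, map_sub, map_smul, map_neg, add_apply, sub_apply, smul_apply, smul_eq_mul]
  rw [h.inner_proj_symm hy u z, h.inner_proj_symm hy v z, h.inner_proj_symm hy v u]
  module

end IsKenmotsuFrame

end LocalRiem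

/-! ### Ricci tensor and its derivative along the frame -/

namespace LocalRiem

variable {E : Type*} [NormedAddCommGroup E] [NormedSpace ℝ E] [FiniteDimensional ℝ E]
  {G : E → E →L[ℝ] E →L[ℝ] ℝ} {U : Set E} {y : E}

theorem ricci_eq_traceCLM (G : E → E →L[ℝ] E →L[ℝ] ℝ) (y u v : E) : ricci G y u v =
    traceCLM E (((curvature G y).flip u).flip v) := rfl

/-- `∇_w Ric` as the trace of `∇_w R`, in terms of coordinate derivatives. -/
theorem IsMetricOn.covDeriv_ricci_eq_trace (h : IsMetricOn G U) (hy : y ∈ U) (w v z : E) :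
    fderiv ℝ (ricci G) y w v z - ricci G y (christoffel G y w v) z
      - ricci G y v (christoffel G y w z) =
    traceCLM E (((fderiv ℝ (curvature G) y w).flip v).flip z
      + christoffel G y w ∘L ((curvature G y).flip v).flip z
      - ((curvature G y).flip v).flip (christoffel G y w z)
      - ((curvature G y).flip v).flip z ∘L christoffel G y w
      - ((curvature G y).flip (christoffel G y w v)).flip z) := by
  have hR := differentiableAt_of_contDiffOn h.isOpen h.contDiffOn_curvature hy
  have hRic := differentiableAt_of_contDiffOn h.isOpen h.contDiffOn_ricci hy
  have e : fderiv ℝ (ricci G) y w v z =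
      traceCLM E (((fderiv ℝ (curvature G) y w).flip v).flip z) := by
    let T : (E →L[ℝ] E →L[ℝ] E →L[ℝ] E) →L[ℝ] ℝ := LinearMap.toContinuousLinearMap
      { toFun := fun R => traceCLM E ((R.flip v).flip z)
        map_add' := fun R R' => by rw [← map_add]; rfl
        map_smul' := fun c R => by rw [RingHom.id_apply, ← map_smul]; rfl }
    have e1 : fderiv ℝ (fun x => ricci G x v z) y w = fderiv ℝ (ricci G) y w v z := by
      rw [fderiv_bilin_apply_eq hRic (differentiableAt_const v) (differentiableAt_const z)]
      simp
    have e2 : (fun x => ricci G x v z) = fun x => T (curvature G x) := rfl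
    have e3 : HasFDerivAt (fun x => T (curvature G x)) (T ∘L fderiv ℝ (curvature G) y) y :=
      T.hasFDerivAt.comp y hR.hasFDerivAt
    rw [← e1, e2, e3.fderiv]
    rfl
  -- The commutator of Γ_w with the traced endomorphism has trace zero.
  simp only [map_add, map_sub, traceCLM_comp_comm (christoffel G y w), e, ricci_eq_traceCLM]
  ring

/-- `∇_w Ric = 0` if `∇_w Ric♯ = 0`. -/
theorem IsMetricOn.covDeriv_ricci_eq_zero (h : IsMetricOn G U) (hy : y ∈ U) {w : E}
    (hw : covDerivEndo G (ricciOp G) y w = 0) (v z : E) :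
    fderiv ℝ (ricci G) y w v z - ricci G y (christoffel G y w v) z
      - ricci G y v (christoffel G y w z) = 0 := by
  have hRic := differentiableAt_of_contDiffOn h.isOpen h.contDiffOn_ricci hy
  have hOp := differentiableAt_of_contDiffOn h.isOpen h.contDiffOn_ricciOp hy
  have e1 : fderiv ℝ (fun x => ricci G x v z) y w = fderiv ℝ (ricci G) y w v z := by
    rw [fderiv_bilin_apply_eq hRic (differentiableAt_const v) (differentiableAt_const z)]
    simp
  have e2 := congrArg (fun x => G y (x v) z) hw
  simp only [covDerivEndo_apply, map_add, map_sub, add_apply, sub_apply, zero_apply, map_zero,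
    h.inner_ricciOp hy] at e2
  rw [← e1, fderiv_eq_of_eqOn h.isOpen (fun x hx => (h.inner_ricciOp hx v z).symm) hy,
    fderiv_bilin_apply_eq (differentiableAt_of_contDiffOn h.isOpen h.smooth hy)
      (hOp.clm_apply (differentiableAt_const v)) (differentiableAt_const z),
    fderiv_clm_apply_const hOp, h.fderiv_eq hy, h.inner_ricciOp hy]
  simp only [fderiv_fun_const, Pi.zero_apply, zero_apply, map_zero]
  linarith

namespace IsKenmotsuFrame

variable {ι : Type*} [Fintype ι] [DecidableEq ι] {ξ : ι → E → E} {β : ℝ}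
  (h : IsKenmotsuFrame G U ξ β) (hy : y ∈ U)
include h hy

local notation "P" => horizontalProj G ξ

theorem trace_proj : traceCLM E (P y) = Module.finrank ℝ E - Fintype.card ι := by
  simp [horizontalProj, traceCLM_id, traceCLM_smulRight, h.orthonormal y hy]

/-- The Ricci tensor on `ξ_j`, in the first argument. -/
theorem ricci_xi_left (j : ι) (v : E) : ricci G y (ξ j y) v =
    -((Module.finrank ℝ E - Fintype.card ι : ℝ) * β ^ 2) * G y (∑ k, ξ k y) v := by
  have e : ((curvature G y).flip (ξ j y)).flip v =
      β ^ 2 • ((G y (P y v)).smulRight (∑ k, ξ k y) - G y (∑ k, ξ k y) v • P y) := by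
    ext1 u
    exact h.curvature_xi_right hy j u v
  have h0 : G y (P y v) (∑ k, ξ k y) = 0 := by simp [h.inner_proj_xi hy]
  rw [ricci_eq_traceCLM, e, map_smul, map_sub, map_smul, traceCLM_smulRight, h.trace_proj hy, h0]
  simp only [smul_eq_mul]
  ring

/-- The Ricci tensor on `ξ_j`, in the second argument. -/
theorem ricci_xi_right (j : ι) (v : E) : ricci G y v (ξ j y) =
    -((Module.finrank ℝ E - Fintype.card ι : ℝ) * β ^ 2) * G y (∑ k, ξ k y) v := by
  have e : ((curvature G y).flip v).flip (ξ j y) =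
      β ^ 2 • ((G y (∑ k, ξ k y)).smulRight (P y v) - G y (∑ k, ξ k y) v • P y) := by
    ext1 u
    exact h.curvature_xi hy j u v
  have h0 : G y (∑ k, ξ k y) (P y v) = 0 := by simp [h.inner_xi_proj hy]
  rw [ricci_eq_traceCLM, e, map_smul, map_sub, map_smul, traceCLM_smulRight, h.trace_proj hy, h0]
  simp only [smul_eq_mul]
  ring

/-- The derivative of the Ricci tensor along `ξ_j`, on vectors orthogonal to all `ξ_k`. -/
theorem covDeriv_ricci_xi (j : ι) {v z : E} (hv : P y v = v) (hz : P y z = z) :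
    fderiv ℝ (ricci G) y (ξ j y) v z - ricci G y (christoffel G y (ξ j y) v) z
      - ricci G y v (christoffel G y (ξ j y) z) =
    -2 * β * (ricci G y v z + Fintype.card ι * (Module.finrank ℝ E - Fintype.card ι : ℝ) * β ^ 2
      * G y v z) := by
  have hv0 : G y (∑ k, ξ k y) v = 0 := by
    rw [← hv]; simp [h.inner_xi_proj hy]
  have hz0 : G y (∑ k, ξ k y) z = 0 := by
    rw [← hz]; simp [h.inner_xi_proj hy]
  have e : ((fderiv ℝ (curvature G) y (ξ j y)).flip v).flip z
      + christoffel G y (ξ j y) ∘L ((curvature G y).flip v).flip z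
      - ((curvature G y).flip v).flip (christoffel G y (ξ j y) z)
      - ((curvature G y).flip v).flip z ∘L christoffel G y (ξ j y)
      - ((curvature G y).flip (christoffel G y (ξ j y) v)).flip z =
      β • (-(((curvature G y).flip v).flip z ∘L P y) - ((curvature G y).flip v).flip z)
      - β ^ 3 • (G y v z • (G y (∑ k, ξ k y)).smulRight (∑ k, ξ k y)
        + (2 * (Fintype.card ι : ℝ)) • (G y z v • P y - (G y z).smulRight v)) := by
    ext1 u
    have := h.covDeriv_curvature_xi hy j u v z
    rw [hv0, hz0, hv, hz, curvature_antisymm G y v] at this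
    simp only [mul_zero, sub_zero, zero_smul, add_zero] at this
    simp only [add_apply, sub_apply, smul_apply, neg_apply, ContinuousLinearMap.flip_apply,
      ContinuousLinearMap.comp_apply, ContinuousLinearMap.smulRight_apply]
    rw [this, mul_smul]
  -- The horizontal trace is the full trace minus ∑ g(ξ_k, R(ξ_k,v)z), and each of these summands
  -- equals -β² g(v,z).
  have hPz : traceCLM E (((curvature G y).flip v).flip z ∘L P y) =
      ricci G y v z + Fintype.card ι * β ^ 2 * G y v z := by
    have hc : ((curvature G y).flip v).flip z ∘L P y = ((curvature G y).flip v).flip z -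
        ∑ k, (G y (ξ k y)).smulRight (curvature G y (ξ k y) v z) := by
      ext1 u
      simp [horizontalProj_apply]
    have hk : ∀ k, G y (ξ k y) (curvature G y (ξ k y) v z) = - (β ^ 2 * G y v z) := fun k => by
      rw [h.symm y hy (ξ k y), curvature_antisymm, h.curvature_xi_right hy, hz, hv, hz0,
        h.symm y hy z v]
      simp only [zero_smul, sub_zero, map_neg, map_smul, neg_apply, smul_apply, smul_eq_mul,
        h.inner_sum_xi hy, mul_one]
    rw [hc, map_sub, map_sum]
    simp only [traceCLM_smulRight, hk, ← ricci_eq_traceCLM]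
    simp
    ring
  rw [h.covDeriv_ricci_eq_trace hy, e]
  simp only [map_add, map_sub, map_smul, map_neg, traceCLM_smulRight, hPz, h.trace_proj hy,
    h.inner_sum_xi_sum_xi hy, smul_eq_mul, ← ricci_eq_traceCLM, h.symm y hy z v]
  ring

/-- The Ricci tensor when `∇_{ξ_j} Ric♯ = 0`. -/
theorem ricci_eq (hβ : β ≠ 0) {j : ι} (hj : covDerivEndo G (ricciOp G) y (ξ j y) = 0) (u v : E) :
    ricci G y u v = -((Module.finrank ℝ E - Fintype.card ι : ℝ) * β ^ 2) *
      (Fintype.card ι * G y (P y u) v + G y (∑ k, ξ k y) u * G y (∑ k, ξ k y) v) := by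
  have hperp : ricci G y (P y u) (P y v) =
      -((Module.finrank ℝ E - Fintype.card ι : ℝ) * β ^ 2) *
        (Fintype.card ι * G y (P y u) v) := by
    have e := h.covDeriv_ricci_xi hy j (h.proj_proj hy u) (h.proj_proj hy v)
    rw [h.covDeriv_ricci_eq_zero hy hj, h.inner_proj_right hy, h.proj_proj hy] at e
    -- The factor cancelled here is -2β.
    have := (mul_eq_zero.1 e.symm).resolve_left (by simpa using hβ)
    linarith
  have hu : u = P y u + ∑ k, G y (ξ k y) u • ξ k y := by rw [horizontalProj_apply]; abel
  have hv : v = P y v + ∑ k, G y (ξ k y) v • ξ k y := by rw [horizontalProj_apply]; abel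
  have e1 : ricci G y u v = ricci G y (P y u) v + ∑ k, G y (ξ k y) u * ricci G y (ξ k y) v := by
    conv_lhs => rw [hu]
    simp
  have e2 : ricci G y (P y u) v = ricci G y (P y u) (P y v) := by
    conv_lhs => rw [hv]
    simp [h.ricci_xi_right hy, h.inner_xi_proj hy]
  rw [e1, e2, hperp]
  simp only [h.ricci_xi_left hy, ← Finset.sum_mul]
  have e3 : G y (∑ k, ξ k y) u = ∑ k, G y (ξ k y) u := by simp
  rw [e3]
  ring

/-- The scalar curvature when `∇_{ξ_j} Ric♯ = 0`. -/
theorem scalarCurvature_eq (hβ : β ≠ 0) {j : ι}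
    (hj : covDerivEndo G (ricciOp G) y (ξ j y) = 0) :
    scalarCurvature G y = -((Module.finrank ℝ E - Fintype.card ι : ℝ) * β ^ 2) *
      (Fintype.card ι * (Module.finrank ℝ E - Fintype.card ι + 1 : ℝ)) := by
  have e : ricciOp G y = -((Module.finrank ℝ E - Fintype.card ι : ℝ) * β ^ 2) •
      ((Fintype.card ι : ℝ) • P y + (G y (∑ k, ξ k y)).smulRight (∑ k, ξ k y)) := by
    ext1 u
    refine h.eq_of_inner_eq hy fun v => ?_
    rw [h.inner_ricciOp hy, h.ricci_eq hy hβ hj]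
    simp only [add_apply, smul_apply, map_smul, map_add, ContinuousLinearMap.smulRight_apply,
      smul_eq_mul]
  change traceCLM E (ricciOp G y) = _
  rw [e, map_smul, map_add, map_smul, traceCLM_smulRight, h.trace_proj hy,
    h.inner_sum_xi_sum_xi hy]
  simp only [smul_eq_mul]
  ring

end IsKenmotsuFrame

end LocalRiem

/-! ### Smoothness of coordinate expressions -/

namespace ChartRep

variable {E : Type*} [NormedAddCommGroup E] [NormedSpace ℝ E]
  {M : Type*} [TopologicalSpace M] [ChartedSpace E M]

section Inverse

variable [IsManifold 𝓘(ℝ, E) ∞ M] {c : M} {y : E} (hy : y ∈ (extChartAt 𝓘(ℝ, E) c).target)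
include hy

theorem ofTangent_toTangent (u : E) : ofTangent c y (toTangent c y u) = u := by
  have h := mfderiv_extChartAt_comp_mfderivWithin_extChartAt_symm (I := 𝓘(ℝ, E)) hy
  rw [ModelWithCorners.range_eq_univ, mfderivWithin_univ] at h
  exact DFunLike.congr_fun h u

theorem toTangent_ofTangent (X : TangentSpace 𝓘(ℝ, E) (pt c y)) :
    toTangent c y (ofTangent c y X) = X := by
  have h := mfderivWithin_extChartAt_symm_comp_mfderiv_extChartAt (I := 𝓘(ℝ, E)) hy
  rw [ModelWithCorners.range_eq_univ, mfderivWithin_univ] at h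
  exact DFunLike.congr_fun h X

/-- The fibre coordinate of the tangent bundle trivialization at c is the differential of the chart;
this turns smoothness of sections into smoothness in coordinates. -/
theorem trivializationAt_snd (X : TangentSpace 𝓘(ℝ, E) (pt c y)) :
    (trivializationAt E (TangentSpace 𝓘(ℝ, E)) c ⟨pt c y, X⟩).2 = ofTangent c y X := by
  have hs : pt c y ∈ (chartAt E c).source := by
    simpa [pt] using (extChartAt 𝓘(ℝ, E) c).map_target hy
  have h := TangentBundle.continuousLinearMapAt_trivializationAt (I := 𝓘(ℝ, E)) hs
  rw [ofTangent, ← h, Trivialization.continuousLinearMapAt_apply,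
    Trivialization.linearMapAt_apply, if_pos]
  simpa using hs

theorem mk_mem_trivializationAt_source (X : TangentSpace 𝓘(ℝ, E) (pt c y)) :
    (⟨pt c y, X⟩ : TotalSpace E (TangentSpace 𝓘(ℝ, E) : M → Type _)) ∈
      (trivializationAt E (TangentSpace 𝓘(ℝ, E)) c).source := by
  rw [Trivialization.mem_source]
  simpa [pt] using (extChartAt 𝓘(ℝ, E) c).map_target hy

end Inverse

variable [IsManifold 𝓘(ℝ, E) ∞ M] (c : M)

theorem contMDiffOn_pt :
    ContMDiffOn 𝓘(ℝ, E) 𝓘(ℝ, E) ∞ (pt c : E → M) (extChartAt 𝓘(ℝ, E) c).target :=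
  contMDiffOn_extChartAt_symm c

theorem contDiffOn_ofTangent {V : Π y : E, TangentSpace 𝓘(ℝ, E) (pt c y)}
    (hV : ContMDiffOn 𝓘(ℝ, E) (𝓘(ℝ, E).prod 𝓘(ℝ, E)) ∞
      (fun y => TotalSpace.mk' E (E := (TangentSpace 𝓘(ℝ, E) : M → Type _)) (pt c y) (V y))
      (extChartAt 𝓘(ℝ, E) c).target) :
    ContDiffOn ℝ ∞ (fun y => ofTangent c y (V y)) (extChartAt 𝓘(ℝ, E) c).target := by
  rw [Trivialization.contMDiffOn_iff
    (fun y hy => mk_mem_trivializationAt_source hy (V y))] at hV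
  exact hV.2.contDiffOn.congr fun y hy => (trivializationAt_snd hy (V y)).symm

/-- In the trivialization at c a coordinate vector field is constant. Evaluating tensors on these
fields reads off their components. -/
theorem contMDiffOn_toTangent (u : E) :
    ContMDiffOn 𝓘(ℝ, E) (𝓘(ℝ, E).prod 𝓘(ℝ, E)) ∞
      (fun y => TotalSpace.mk' E (E := (TangentSpace 𝓘(ℝ, E) : M → Type _)) (pt c y)
        (toTangent c y u))
      (extChartAt 𝓘(ℝ, E) c).target := by
  rw [Trivialization.contMDiffOn_iff
    (fun y hy => mk_mem_trivializationAt_source hy _)]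
  refine ⟨contMDiffOn_pt c, (contMDiffOn_const (c := u)).congr fun y hy => ?_⟩
  exact (trivializationAt_snd hy _).trans (ofTangent_toTangent hy u)

theorem contDiffOn_vec {X : Π p : M, TangentSpace 𝓘(ℝ, E) p}
    (hX : ContMDiff 𝓘(ℝ, E) (𝓘(ℝ, E).prod 𝓘(ℝ, E)) ∞
      (fun p => TotalSpace.mk' E (E := fun p : M => TangentSpace 𝓘(ℝ, E) p) p (X p))) :
    ContDiffOn ℝ ∞ (vec X c) (extChartAt 𝓘(ℝ, E) c).target :=
  contDiffOn_ofTangent c (hX.comp_contMDiffOn (contMDiffOn_pt c))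

variable [FiniteDimensional ℝ E]

theorem contDiffOn_endo
    {A : Π p : M, TangentSpace 𝓘(ℝ, E) p →L[ℝ] TangentSpace 𝓘(ℝ, E) p}
    (hA : ContMDiff 𝓘(ℝ, E) (𝓘(ℝ, E).prod 𝓘(ℝ, E →L[ℝ] E)) ∞
      (fun p => TotalSpace.mk' (E →L[ℝ] E)
        (E := fun p : M => TangentSpace 𝓘(ℝ, E) p →L[ℝ] TangentSpace 𝓘(ℝ, E) p) p (A p))) :
    ContDiffOn ℝ ∞ (endo A c) (extChartAt 𝓘(ℝ, E) c).target :=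
  contDiffOn_clm_apply.2 fun u => contDiffOn_ofTangent c
    (ContMDiffOn.clm_bundle_apply (F₁ := E) (F₂ := E)
      (hA.comp_contMDiffOn (contMDiffOn_pt c)) (contMDiffOn_toTangent c u))

theorem contDiffOn_bilin
    {B : Π p : M, TangentSpace 𝓘(ℝ, E) p →L[ℝ] TangentSpace 𝓘(ℝ, E) p →L[ℝ] ℝ}
    (hB : ContMDiff 𝓘(ℝ, E) (𝓘(ℝ, E).prod 𝓘(ℝ, E →L[ℝ] E →L[ℝ] ℝ)) ∞
      (fun p => TotalSpace.mk' (E →L[ℝ] E →L[ℝ] ℝ)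
        (E := fun p : M => TangentSpace 𝓘(ℝ, E) p →L[ℝ] TangentSpace 𝓘(ℝ, E) p →L[ℝ] ℝ)
          p (B p))) :
    ContDiffOn ℝ ∞ (bilin B c) (extChartAt 𝓘(ℝ, E) c).target := by
  refine contDiffOn_clm_apply.2 fun u => contDiffOn_clm_apply.2 fun v => ?_
  have h : ContMDiffOn 𝓘(ℝ, E) (𝓘(ℝ, E).prod 𝓘(ℝ)) ∞
      (fun y => TotalSpace.mk' ℝ (E := Bundle.Trivial M ℝ) (pt c y)
        (B (pt c y) (toTangent c y u) (toTangent c y v))) (extChartAt 𝓘(ℝ, E) c).target := by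
    apply ContMDiffOn.clm_bundle_apply₂ (F₁ := E) (F₂ := E)
    · exact hB.comp_contMDiffOn (contMDiffOn_pt c)
    · exact contMDiffOn_toTangent c u
    · exact contMDiffOn_toTangent c v
  intro y hy
  have hy' := h y hy
  simp only [contMDiffWithinAt_totalSpace] at hy'
  exact hy'.2.contDiffWithinAt

end ChartRep

/-! ### Transfer of the structure to charts and conclusion -/

namespace WeakMetricFStructure

variable {n s : ℕ} {M : Type*} [TopologicalSpace M] [ChartedSpace (CoordSpace n s) M]
  [IsManifold 𝓘(ℝ, CoordSpace n s) ∞ M] (S : WeakMetricFStructure n s M) (c : M)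

open ChartRep LocalRiem

theorem localMetric_apply (y u v : CoordSpace n s) : S.localMetric c y u v =
    S.g.inner (pt c y) (toTangent c y u) (toTangent c y v) := rfl

theorem isMetricOn_localMetric :
    IsMetricOn (S.localMetric c) (extChartAt 𝓘(ℝ, CoordSpace n s) c).target where
  isOpen := isOpen_extChartAt_target c
  smooth := contDiffOn_bilin c S.g.contMDiff
  symm y _ u v := by rw [localMetric_apply, localMetric_apply, S.g.symm]
  pos y hy u hu := by
    rw [localMetric_apply]
    refine S.g.pos _ _ fun h => hu ?_
    rw [← ofTangent_toTangent hy u, h, map_zero]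

theorem isWeakMetricF_chart {y : CoordSpace n s}
    (hy : y ∈ (extChartAt 𝓘(ℝ, CoordSpace n s) c).target) :
    IsWeakMetricF (endo S.f c y) (endo S.Q c y) (fun k => vec (S.ξ k) c y)
      (fun k => form (S.η k) c y) (S.localMetric c y) where
  nonsingular := by
    have h1 : Function.Bijective (ofTangent c y) :=
      Function.bijective_iff_has_inverse.2
        ⟨toTangent c y, toTangent_ofTangent hy, ofTangent_toTangent hy⟩
    have h2 : Function.Bijective (toTangent c y) :=
      Function.bijective_iff_has_inverse.2
        ⟨ofTangent c y, ofTangent_toTangent hy, toTangent_ofTangent hy⟩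
    exact h1.comp ((S.nonsingular_Q (pt c y)).comp h2)
  f_cubed X := by
    have h := congrArg (ofTangent c y) (S.f_cubed (pt c y) (toTangent c y X))
    rw [map_add, map_zero] at h
    simp only [endo, ContinuousLinearMap.comp_apply, toTangent_ofTangent hy]
    exact h
  f_squared X := by
    have h := congrArg (ofTangent c y) (S.f_squared (pt c y) (toTangent c y X))
    rw [map_add, map_neg, map_sum] at h
    simp only [map_smul] at h
    simp only [endo, vec, form, ContinuousLinearMap.comp_apply, toTangent_ofTangent hy]
    exact h
  eta_xi i j := by
    simp only [vec, form, ContinuousLinearMap.comp_apply, toTangent_ofTangent hy]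
    exact S.η_ξ _ i j
  Q_xi i := by
    simp only [vec, endo, ContinuousLinearMap.comp_apply, toTangent_ofTangent hy, S.Q_ξ]
  f_invariant X hX i := by
    simp only [form, endo, ContinuousLinearMap.comp_apply, toTangent_ofTangent hy] at hX ⊢
    exact S.f_invariant _ _ hX i
  compatible X Y := by
    have h := S.compatible (pt c y) (toTangent c y X) (toTangent c y Y)
    simp only [localMetric_apply, form, endo, ContinuousLinearMap.comp_apply, toTangent_ofTangent hy]
    exact h
  symm X Y := by rw [localMetric_apply, localMetric_apply, S.g.symm]

variable {S} in
theorem IsWeakKenmotsu.isKenmotsuFrame {β : ℝ} (hK : S.IsWeakKenmotsu fun _ => β) :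
    IsKenmotsuFrame (S.localMetric c) (extChartAt 𝓘(ℝ, CoordSpace n s) c).target
      (fun k => vec (S.ξ k) c) β :=
  isKenmotsuFrame_of_normal (Q := endo S.Q c) (η := fun k => form (S.η k) c)
    (S.isMetricOn_localMetric c)
    (fun k => contDiffOn_vec c (S.smooth_ξ k)) (contDiffOn_endo c S.smooth_f)
    (fun _ hz => S.isWeakMetricF_chart c hz)
    (fun z hz _ _ => hK.normal c z hz _ _ contDiff_const contDiff_const)
    (fun z hz u v => by
      have e1 : vec S.xiBar c z = ∑ k, vec (S.ξ k) c z := by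
        simp only [vec, xiBar, map_sum]
      have e2 : form S.etaBar c z v = ∑ k, form (S.η k) c z v := by
        simp only [form, etaBar, ContinuousLinearMap.comp_apply, sum_apply]
      rw [← e1, ← e2]
      exact hK.nabla_f c z hz u v)

end WeakMetricFStructure

theorem theorem2p3 (n s : ℕ) (hn : 0 < n) (hs : 1 < s)
    (M : Type*) [TopologicalSpace M] [ChartedSpace (CoordSpace n s) M]
    [IsManifold 𝓘(ℝ, CoordSpace n s) ∞ M]
    (S : WeakMetricFStructure n s M) (β : ℝ)
    (hK : S.IsWeakKenmotsu (fun _ => β))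
    (i : Fin s) (hRic : S.NablaXiRicciOpEqZero i) :
    S.IsEtaEinstein ∧
      S.HasScalarCurvature (-2 * (s : ℝ) * (n : ℝ) * (2 * (n : ℝ) + 1) * β ^ 2) := by
  -- In -2nβ² (s g(P·,·) + η̄ ⊗ η̄), expand g(P·,·) = g - ∑ η^i ⊗ η^i and split η̄ ⊗ η̄ into
  -- diagonal and off-diagonal parts. The coefficients are a = -2snβ², b = 2n(s-1)β² and a + b =
  -- -2nβ².
  refine ⟨⟨fun _ => -2 * s * n * β ^ 2, fun _ => 2 * n * (s - 1) * β ^ 2, contMDiff_const,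
    contMDiff_const, fun c y hy X Y => ?_⟩, fun c y hy => ?_⟩
  · have hF := hK.isKenmotsuFrame c
    have hW := S.isWeakMetricF_chart c hy
    rw [hF.ricci_eq hy (hK.β_ne_zero c) (hRic c y hy), LocalRiem.IsKenmotsuFrame.inner_proj_left]
    have e1 : ∀ k Z, ChartRep.form (S.η k) c y Z =
        S.localMetric c y (ChartRep.vec (S.ξ k) c y) Z := fun k Z => hW.eta_eq k Z
    have e2 : ∀ x z : Fin s → ℝ, ∑ k, ∑ l ∈ Finset.univ.filter (fun l => l ≠ k), x k * z l =
        (∑ k, x k) * (∑ k, z k) - ∑ k, x k * z k := fun x z => by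
      rw [Finset.sum_mul_sum, ← Finset.sum_sub_distrib]
      refine Finset.sum_congr rfl fun k _ => ?_
      rw [Finset.filter_ne', ← Finset.add_sum_erase Finset.univ _ (Finset.mem_univ k)]
      ring
    simp only [e1, e2, map_sum, sum_apply]
    simp
    ring
  · rw [(hK.isKenmotsuFrame c).scalarCurvature_eq hy (hK.β_ne_zero c) (hRic c y hy)]
    simp
    ring
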